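/- Let $X\subset\mathbb P^n(\mathbb C)$ be a smooth complex projective surface with its classical topology, and let $V=V_1\cup\dots\cup V_k\subset X$ be an algebraic curve whose irreducible components $V_1,\dots,V_k$ are distinct smooth curves intersecting in normal crossings, i.e. near every point of $V_i\cap V_j$ ($i\ne j$) the pair $(X,V)$ is locally biholomorphic to $(\mathbb C^2,\{x=0\}\cup\{y=0\})$. Let $Q=\bigcup_{i\neq j}V_i\cap V_j$. For each $i$ let $T(V_i)\subset X$ be an embedded closed tubular neighborhood of $V_i$, that is, the image of the closed unit disc bundle of a real plane bundle with fibrewise inner product over $V_i$ under a topological embedding that is the inclusion on the zero section and maps the open unit disc bundle onto an open set $T^\circ(V_i)$; let $p_i:T(V_i)\to V_i$ be the projection and $S(V_i)\subset T(V_i)$ the unit circle bundle. Assume that there are pairwise disjoint neighborhoods $N(q)$ of the points $q\in Q$ such that $T(V_i)\cap T(V_j)=\bigcup_{q\in V_i\cap V_j}N(q)$ for $i\neq j$, and that for $q\in V_i\cap V_j$, $i\ne j$, one has $p_i^{-1}(V_i\cap N(q))=N(q)=p_j^{-1}(V_j\cap N(q))$ and there is a homeomorphism $$N(q)\cong\{|x|\le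 1\}\times\{|y|\le 1\}$$ taking $q$ to $(0,0)$, $V_i\cap N(q)$ to $\{y=0\}$, $V_j\cap N(q)$ to $\{x=0\}$, $S(V_i)\cap N(q)$ to $\{|y|=1\}$, $S(V_j)\cap N(q)$ to $\{|x|=1\}$, and $p_i$, $p_j$ to $(x,y)\mapsto(x,0)$, $(x,y)\mapsto(0,y)$. Put $$T(V)=\bigcup_{i=1}^k T(V_i),\qquad V_i^c=V_i\setminus\bigcup_{j\ne i}\bigl(T^\circ(V_i)\cap T^\circ(V_j)\bigr),\qquad S(V)=\bigcup_{i=1}^k S(V_i)\cap p_i^{-1}(V_i^c).$$ Then $S(V)\subset T(V)\setminus V$, and $T(V)\setminus V$ has a (strong) deformation retraction to $S(V)$: there is a continuous map $H:[0,1]\times(T(V)\setminus V)\to T(V)\setminus V$ with $H(0,z)=z$ and $H(1,z)\in S(V)$ for all $z\in T(V)\setminus V$, and $H(t,s)=s$ for all $s\in S(V)$ and $t\in[0,1]$. -/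

import Mathlib

open Set Topology Bundle
open scoped LinearAlgebra.Projectivization unitInterval

noncomputable section

/-! ### Complex projective space and its smooth projective subvarieties -/

/-- Complex projective `n`-space, as a set of lines in `ℂ ^ (n + 1)`. -/
abbrev PSpace (n : ℕ) : Type := ℙ ℂ (Fin (n + 1) → ℂ)

/-- The complex (classical) topology of projective space: the quotient topology from
`ℂ ^ (n + 1) ∖ {0}`. -/
instance PSpace.topologicalSpace (n : ℕ) : TopologicalSpace (PSpace n) :=
  TopologicalSpace.coinduced (Projectivization.mk' ℂ)
    (inferInstance : TopologicalSpace {v : Fin (n + 1) → ℂ // v ≠ 0})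

/-- A homogeneous polynomial (of some degree) in `n + 1` variables. -/
def IsForm {n : ℕ} (f : MvPolynomial (Fin (n + 1)) ℂ) : Prop := ∃ d : ℕ, f.IsHomogeneous d

/-- The form `f` vanishes at the point `p`. For a homogeneous `f` this does not depend on the
chosen homogeneous coordinates of `p`. -/
def VanishesAt {n : ℕ} (f : MvPolynomial (Fin (n + 1)) ℂ) (p : PSpace n) : Prop :=
  MvPolynomial.eval p.rep f = 0

/-- A projective algebraic set: the common zero set of a set of forms. -/
def IsProjAlgebraic {n : ℕ} (Z : Set (PSpace n)) : Prop :=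
  ∃ S : Set (MvPolynomial (Fin (n + 1)) ℂ), (∀ f ∈ S, IsForm f) ∧
    Z = {p | ∀ f ∈ S, VanishesAt f p}

/-- `Z` is nonempty and irreducible in the Zariski topology. -/
def IsZariskiIrreducible {n : ℕ} (Z : Set (PSpace n)) : Prop :=
  Z.Nonempty ∧ ∀ A B : Set (PSpace n), IsProjAlgebraic A → IsProjAlgebraic B →
    Z ⊆ A ∪ B → Z ⊆ A ∨ Z ⊆ B

/-- `Z` is a smooth projective algebraic set, all of whose components have dimension `d`: near each
of its points (in the Zariski topology) it is cut out by `n - d` forms whose differentials at that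
point are linearly independent. -/
def IsSmoothProjective {n : ℕ} (d : ℕ) (Z : Set (PSpace n)) : Prop :=
  IsProjAlgebraic Z ∧ ∀ p ∈ Z, ∃ (m : ℕ) (f : Fin m → MvPolynomial (Fin (n + 1)) ℂ)
    (g : MvPolynomial (Fin (n + 1)) ℂ),
    m + d = n ∧ (∀ a, IsForm (f a)) ∧ IsForm g ∧ ¬ VanishesAt g p ∧
    LinearIndependent ℂ
      (fun a : Fin m => fun b : Fin (n + 1) =>
        MvPolynomial.eval p.rep (MvPolynomial.pderiv b (f a))) ∧
    ∀ w : PSpace n, ¬ VanishesAt g w → (w ∈ Z ↔ ∀ a, VanishesAt (f a) w)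

/-! ### Curves with normal crossings on a surface -/

/-- `φ` is a biholomorphic map from the open set `W ⊆ ℂ²` onto an open subset of the surface `X`:
it is a homeomorphism onto an open subset of `X`, it is given in homogeneous coordinates by a
holomorphic map `F`, and it is an immersion into projective space. -/
def IsHolomorphicParametrization {n : ℕ} (X : Set (PSpace n)) (W : Set (ℂ × ℂ)) (φ : W → X) :
    Prop :=
  IsOpen W ∧ IsOpenEmbedding φ ∧
    ∃ F : ℂ × ℂ → (Fin (n + 1) → ℂ), DifferentiableOn ℂ F W ∧
      ∀ w : W, (∃ h : F w ≠ 0, (φ w : PSpace n) = Projectivization.mk ℂ (F w) h) ∧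
        ∀ u : ℂ × ℂ, fderiv ℂ F w u ∈ Submodule.span ℂ {F w} → u = 0

/-- The sets `C i` are the irreducible components of an algebraic curve `⋃ i, C i` on `X`; they are
smooth, and they intersect in normal crossings: near each point of intersection, the pair
`(X, ⋃ i, C i)` is locally isomorphic to `(ℂ², {x = 0} ∪ {y = 0})`. -/
structure IsNormalCrossingCurve {n k : ℕ} (X : Set (PSpace n)) (C : Fin k → Set X) : Prop where
  injective : Function.Injective C
  irreducible : ∀ i, IsZariskiIrreducible ((↑) '' C i : Set (PSpace n))
  smooth : ∀ i, IsSmoothProjective 1 ((↑) '' C i : Set (PSpace n))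
  crossing : ∀ i j, i ≠ j → ∀ q ∈ C i ∩ C j,
    ∃ (W : Set (ℂ × ℂ)) (φ : W → X) (h0 : (0 : ℂ × ℂ) ∈ W),
      IsHolomorphicParametrization X W φ ∧ φ ⟨0, h0⟩ = q ∧
      ∀ w : W, φ w ∈ ⋃ l, C l ↔ (w : ℂ × ℂ).1 = 0 ∨ (w : ℂ × ℂ).2 = 0

/-! ### Tubular neighbourhoods -/

/-- An embedded (closed) tubular neighbourhood of `C` in `M`, of codimension two: an embedding in
`M` of the closed unit disc bundle of a real plane bundle `E` over `C` with a continuous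
fibrewise inner product, which is the inclusion of `C` on the zero section and carries the open unit
disc bundle onto an open subset of `M`. -/
structure TubularNbhd {M : Type*} [TopologicalSpace M] (C : Set M) where
  E : C → Type
  [topTotal : TopologicalSpace (TotalSpace ℂ E)]
  [normed : ∀ c, NormedAddCommGroup (E c)]
  [inner : ∀ c, InnerProductSpace ℝ (E c)]
  [fiberBundle : FiberBundle ℂ E]
  [vectorBundle : VectorBundle ℝ ℂ E]
  [riemannian : IsContinuousRiemannianBundle ℂ E]
  emb : {e : TotalSpace ℂ E // ‖e.2‖ ≤ 1} → M
  isEmbedding : IsEmbedding emb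
  emb_zero : ∀ c : C, emb ⟨⟨c, 0⟩, by simp⟩ = c
  isOpen_image : IsOpen (emb '' {e | ‖e.1.2‖ < 1})

attribute [instance] TubularNbhd.topTotal TubularNbhd.normed TubularNbhd.inner
  TubularNbhd.fiberBundle TubularNbhd.vectorBundle TubularNbhd.riemannian

namespace TubularNbhd

variable {M : Type*} [TopologicalSpace M] {C : Set M}

/-- The closed unit disc bundle. -/
abbrev Disc (T : TubularNbhd C) : Type _ := {e : TotalSpace ℂ T.E // ‖e.2‖ ≤ 1}

/-- The distance `‖e‖` of a point of the disc bundle from the zero section. -/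
def radius (T : TubularNbhd C) (e : T.Disc) : ℝ := ‖e.1.2‖

/-- The point of `C` over which a point of the disc bundle lies. -/
def base (T : TubularNbhd C) (e : T.Disc) : M := (e.1.1 : M)

/-- The closed tubular neighbourhood, as a subset of `M`. -/
def closedTube (T : TubularNbhd C) : Set M := range T.emb

/-- The open tubular neighbourhood, as a subset of `M`. -/
def openTube (T : TubularNbhd C) : Set M := T.emb '' {e | T.radius e < 1}

/-- The boundary circle bundle restricted to `B ⊆ C`. -/
def circleBundle (T : TubularNbhd C) (B : Set M) : Set M :=
  T.emb '' {e | T.radius e = 1 ∧ T.base e ∈ B}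

end TubularNbhd

/-- The closed unit disc in `ℂ`. -/
abbrev ClosedDisc : Type := {z : ℂ // ‖z‖ ≤ 1}

/-- The centre of the closed unit disc. -/
def ClosedDisc.centre : ClosedDisc := ⟨0, by simp⟩

/-- `g` is a homeomorphism from the bidisc `{|x| ≤ 1} × {|y| ≤ 1}` onto the neighbourhood `N` of the
crossing point `q` of `C` and `C'`, which takes `(0, 0)` to `q`, the disc `{y = 0}` onto `C ∩ N` and
the disc `{x = 0}` onto `C' ∩ N`. On `N` the projection of the first tubular neighbourhood is
`(x, y) ↦ (x, 0)` and its circle bundle is `{|y| = 1}`, the projection of the second one is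
`(x, y) ↦ (0, y)` and its circle bundle is `{|x| = 1}`, and `N` is the full part of each tubular
neighbourhood over `C ∩ N`, respectively over `C' ∩ N`. -/
structure IsBidiscChart {M : Type*} [TopologicalSpace M] {C C' : Set M}
    (T : TubularNbhd C) (T' : TubularNbhd C') (q : M) (N : Set M)
    (g : ClosedDisc × ClosedDisc → M) : Prop where
  isEmbedding : IsEmbedding g
  range_eq : range g = N
  map_centre : g (ClosedDisc.centre, ClosedDisc.centre) = q
  mem_left : ∀ x y, g (x, y) ∈ C ↔ y = ClosedDisc.centre
  mem_right : ∀ x y, g (x, y) ∈ C' ↔ x = ClosedDisc.centre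
  base_left : ∀ e x y, T.emb e = g (x, y) → T.base e = g (x, ClosedDisc.centre)
  base_right : ∀ e x y, T'.emb e = g (x, y) → T'.base e = g (ClosedDisc.centre, y)
  radius_left : ∀ e x y, T.emb e = g (x, y) → (T.radius e = 1 ↔ ‖(y : ℂ)‖ = 1)
  radius_right : ∀ e x y, T'.emb e = g (x, y) → (T'.radius e = 1 ↔ ‖(x : ℂ)‖ = 1)
  saturated_left : ∀ e, T.base e ∈ N → T.emb e ∈ N
  saturated_right : ∀ e, T'.base e ∈ N → T'.emb e ∈ N

/-- A choice of tubular neighbourhoods of the subsets `C i` of `M`, such that two of them only meet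
near the points `q` at which the corresponding subsets intersect, in pairwise disjoint
neighbourhoods `N q` of these points, each of which is a bidisc. -/
structure TubularSystem {M : Type*} [TopologicalSpace M] {ι : Type*} (C : ι → Set M) where
  tube : ∀ i, TubularNbhd (C i)
  N : M → Set M
  N_mem_nhds : ∀ i j, i ≠ j → ∀ q ∈ C i ∩ C j, N q ∈ 𝓝 q
  N_disjoint : ∀ i j i' j', i ≠ j → i' ≠ j' → ∀ q ∈ C i ∩ C j, ∀ q' ∈ C i' ∩ C j',
    q ≠ q' → Disjoint (N q) (N q')
  tube_inter : ∀ i j, i ≠ j →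
    (tube i).closedTube ∩ (tube j).closedTube = ⋃ q ∈ C i ∩ C j, N q
  chart : ∀ i j, i ≠ j → ∀ q ∈ C i ∩ C j,
    ∃ g : ClosedDisc × ClosedDisc → M, IsBidiscChart (tube i) (tube j) q (N q) g

namespace TubularSystem

variable {M : Type*} [TopologicalSpace M] {ι : Type*} {C : ι → Set M}

/-- The tubular neighbourhood `T(V)` of `V = ⋃ i, C i`. -/
def nbhd (T : TubularSystem C) : Set M := ⋃ i, (T.tube i).closedTube

/-- The curve `C i` with the open bidiscs about its crossing points removed. -/
def core (T : TubularSystem C) (i : ι) : Set M :=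
  C i \ ⋃ (j : ι) (_ : j ≠ i), (T.tube i).openTube ∩ (T.tube j).openTube

/-- The boundary manifold `S(V)`: the union of the circle bundles over the sets `T.core i`. -/
def boundary (T : TubularSystem C) : Set M := ⋃ i, (T.tube i).circleBundle (T.core i)

end TubularSystem

/-- The subset `S` of `A` is a (strong) deformation retract of `A`. -/
def HasDeformationRetraction {M : Type*} [TopologicalSpace M] (A S : Set M) : Prop :=
  S ⊆ A ∧ ∃ H : C(I × A, A), (∀ x, H (0, x) = x) ∧ (∀ x, (H (1, x) : M) ∈ S) ∧
    ∀ (t : I) (x : A), (x : M) ∈ S → H (t, x) = x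

end

/-! ### Disc bundles of Riemannian vector bundles -/

section DiscBundle

variable {B F : Type*} [TopologicalSpace B] [NormedAddCommGroup F] [NormedSpace ℝ F]
  {E : B → Type*} [TopologicalSpace (TotalSpace F E)] [∀ b, NormedAddCommGroup (E b)]
  [∀ b, InnerProductSpace ℝ (E b)] [FiberBundle F E] [VectorBundle ℝ F E]

/-! Off its zero section, a disc bundle retracts radially onto its circle bundle. Extended by the
identity, this gives for each `i` a deformation `push` that drives points out of the open tube of
`V_i`; it is continuous because the tube is closed, `V_i` being compact in a Hausdorff space. The
deformations for different `i` are compatible: `push` moves points along fibres of `p_i`, and in a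
bidisc such a fibre is a disc `{x} × {|y| ≤ 1}`, while both the open tube of `V_j` and `V_j` itself
are conditions on `x` alone. So the push for `i` never brings a point into the open tube of `V_j` or
into `V_j` (`push_notMem_openTube`, `push_notMem_iUnion`). Composing all pushes therefore ends
outside every open tube, and by `boundary_eq` that part of `T(V)` is exactly `S(V)`. -/

/-- The norm is a continuous function on the total space of a Riemannian vector bundle. -/
theorem continuous_norm_totalSpace [IsContinuousRiemannianBundle F E] :
    Continuous fun e : TotalSpace F E => ‖e.2‖ := by
  have h : Continuous fun e : TotalSpace F E => inner ℝ e.2 e.2 :=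
    Continuous.inner_bundle (b := fun e : TotalSpace F E => e.1) (F := F)
      (v := fun e => e.2) (w := fun e => e.2) continuous_id continuous_id
  simpa only [norm_eq_sqrt_real_inner] using h.sqrt


/-- Fibrewise scalar multiplication is continuous on the total space of a vector bundle. -/
theorem continuous_smul_totalSpace :
    Continuous fun p : ℝ × TotalSpace F E => (⟨p.2.1, p.1 • p.2.2⟩ : TotalSpace F E) := by
  rw [continuous_iff_continuousAt]
  rintro ⟨t, e⟩
  rw [FiberBundle.continuousAt_totalSpace]
  refine ⟨((FiberBundle.continuous_proj F E).comp continuous_snd).continuousAt, ?_⟩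
  set τ := trivializationAt F E e.1
  have he : e ∈ τ.source := FiberBundle.mem_trivializationAt_proj_source
  have h1 : ContinuousAt (fun p : ℝ × TotalSpace F E => p.1 • (τ p.2).2) (t, e) :=
    continuousAt_fst.smul <| continuousAt_snd.comp <|
      (τ.toOpenPartialHomeomorph.continuousAt he).comp continuousAt_snd
  refine h1.congr ?_
  have h2 : ∀ᶠ p : ℝ × TotalSpace F E in 𝓝 (t, e), p.2 ∈ τ.source :=
    continuousAt_snd (τ.open_source.mem_nhds he)
  filter_upwards [h2] with p hp
  exact ((τ.linear ℝ (τ.mem_source.1 hp)).map_smul p.1 p.2.2).symm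

/-- The closed disc bundles of a Riemannian vector bundle over a compact space are compact. -/
theorem isCompact_discBundle [CompactSpace B] [ProperSpace F] [IsContinuousRiemannianBundle F E]
    (r : ℝ) : IsCompact {e : TotalSpace F E | ‖e.2‖ ≤ r} := by
  rw [isCompact_iff_ultrafilter_le_nhds']
  intro u hu
  obtain ⟨b, -, hb⟩ := isCompact_univ.ultrafilter_le_nhds (u.map (π F E)) (by simp)
  have hb : Filter.Tendsto (π F E) u (𝓝 b) := hb
  set τ := trivializationAt F E b
  have hτ : b ∈ τ.baseSet := FiberBundle.mem_baseSet_trivializationAt' b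
  -- `K` bounds the operator norm of the trivialization near `b`, so the fibre coordinates
  -- eventually lie in a compact ball and converge along the ultrafilter.
  obtain ⟨K, hK, hbd⟩ := eventually_norm_trivializationAt_lt F E b
  have hball : ∀ᶠ e in (u : Filter (TotalSpace F E)),
      (τ e).2 ∈ Metric.closedBall (0 : F) (K * r) := by
    filter_upwards [hu, hb hbd, hb (τ.open_baseSet.mem_nhds hτ)] with e he hle hmem
    have h1 := (τ.continuousLinearMapAt ℝ e.1).le_opNorm e.2
    rw [Trivialization.continuousLinearMapAt_apply_of_mem _ _ hmem] at h1
    rw [mem_closedBall_zero_iff]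
    exact h1.trans (mul_le_mul hle.le he (norm_nonneg _) hK.le)
  obtain ⟨v, -, hv⟩ := (isCompact_closedBall (0 : F) (K * r)).ultrafilter_le_nhds'
    (u.map fun e => (τ e).2) hball
  have hmem : τ.toOpenPartialHomeomorph.symm (b, v) ∈ τ.source :=
    τ.map_target (τ.mem_target.2 hτ)
  have hlim : (u : Filter (TotalSpace F E)) ≤ 𝓝 (τ.toOpenPartialHomeomorph.symm (b, v)) := by
    have := (τ.tendsto_nhds_iff (f := id) (l := (u : Filter (TotalSpace F E))) hmem).2
    refine this ⟨?_, ?_⟩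
    · rw [τ.proj_symm_apply' hτ]; exact hb
    · rw [τ.apply_symm_apply' hτ]; exact hv
  exact ⟨_, (isClosed_le continuous_norm_totalSpace continuous_const).mem_of_tendsto
    hlim hu, hlim⟩

end DiscBundle

/-! ### Radial deformation of a single tube -/

namespace TubularNbhd

variable {M : Type*} [TopologicalSpace M] {C : Set M} (T : TubularNbhd C)

theorem emb_injective : Function.Injective T.emb := T.isEmbedding.injective

theorem continuous_radius : Continuous T.radius :=
  continuous_norm_totalSpace.comp continuous_subtype_val

theorem radius_le_one (e : T.Disc) : T.radius e ≤ 1 := e.2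

theorem radius_nonneg (e : T.Disc) : 0 ≤ T.radius e := norm_nonneg _

/-- The point of the zero section over a point of `C`. -/
noncomputable def zero (c : C) : T.Disc := ⟨⟨c, 0⟩, by simp⟩

theorem emb_zero_eq (c : C) : T.emb (T.zero c) = c := T.emb_zero c

theorem radius_zero (c : C) : T.radius (T.zero c) = 0 := norm_zero

theorem emb_mem_iff {e : T.Disc} : T.emb e ∈ C ↔ T.radius e = 0 := by
  constructor
  · intro h
    rw [T.emb_injective (T.emb_zero_eq ⟨_, h⟩).symm, radius_zero]
  · intro h
    have : e = T.zero e.1.1 := by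
      obtain ⟨⟨c, v⟩, hv⟩ := e
      have : v = 0 := norm_eq_zero.1 h
      subst this
      rfl
    rw [this, emb_zero_eq]
    exact e.1.1.2

theorem emb_mem_openTube_iff {e : T.Disc} : T.emb e ∈ T.openTube ↔ T.radius e < 1 :=
  T.emb_injective.mem_set_image

theorem isOpen_openTube : IsOpen T.openTube := T.isOpen_image

theorem openTube_subset_closedTube : T.openTube ⊆ T.closedTube := image_subset_range _ _

theorem subset_openTube : C ⊆ T.openTube := fun c hc =>
  ⟨T.zero ⟨c, hc⟩, by simp [radius_zero], T.emb_zero_eq ⟨c, hc⟩⟩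

theorem isClosed_closedTube [T2Space M] (hC : IsCompact C) : IsClosed T.closedTube := by
  have : CompactSpace C := isCompact_iff_compactSpace.1 hC
  have : CompactSpace T.Disc := isCompact_iff_compactSpace.1 (isCompact_discBundle 1)
  exact (isCompact_range T.isEmbedding.continuous).isClosed

/-- The factor by which a vector of length `r` is stretched at time `t`, when it is moved linearly
to the unit sphere. -/
noncomputable def stretch (t : I) (r : ℝ) : ℝ := (1 - t) + t * r⁻¹

theorem stretch_mul {t : I} {r : ℝ} (hr : r ≠ 0) : stretch t r * r = (1 - t) * r + t := by
  rw [stretch, add_mul, inv_mul_cancel_right₀ hr]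

theorem stretch_nonneg {t : I} {r : ℝ} (hr : 0 ≤ r) : 0 ≤ stretch t r :=
  add_nonneg (sub_nonneg.2 t.2.2) (mul_nonneg t.2.1 (inv_nonneg.2 hr))

/-- The radial deformation of the disc bundle, away from the zero section, to the circle bundle. -/
noncomputable def pushDisc (t : I) (e : T.Disc) : T.Disc :=
  ⟨⟨e.1.1, stretch t (T.radius e) • e.1.2⟩, by
    rw [norm_smul, Real.norm_of_nonneg (stretch_nonneg (T.radius_nonneg e))]
    change stretch t (T.radius e) * T.radius e ≤ 1
    -- On the zero section `r⁻¹` takes the default value `0`, but the stretched vector is zero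
    -- anyway.
    rcases eq_or_ne (T.radius e) 0 with h | h
    · simp [h]
    · rw [stretch_mul h]
      nlinarith [t.2.1, t.2.2, T.radius_le_one e]⟩

theorem base_pushDisc (t : I) (e : T.Disc) : T.base (T.pushDisc t e) = T.base e := rfl

theorem radius_pushDisc (t : I) {e : T.Disc} (he : T.radius e ≠ 0) :
    T.radius (T.pushDisc t e) = (1 - t) * T.radius e + t := by
  rw [← stretch_mul he]
  change ‖stretch t (T.radius e) • e.1.2‖ = _
  rw [norm_smul, Real.norm_of_nonneg (stretch_nonneg (T.radius_nonneg e))]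
  rfl

theorem radius_pushDisc_pos (t : I) {e : T.Disc} (he : T.radius e ≠ 0) :
    0 < T.radius (T.pushDisc t e) := by
  rw [radius_pushDisc T t he]
  have := lt_of_le_of_ne (T.radius_nonneg e) he.symm
  nlinarith [t.2.1, t.2.2, T.radius_le_one e]

theorem pushDisc_zero (e : T.Disc) : T.pushDisc 0 e = e := by
  obtain ⟨⟨c, v⟩, hv⟩ := e
  simp [pushDisc, stretch]

theorem pushDisc_of_radius_eq_one (t : I) {e : T.Disc} (he : T.radius e = 1) :
    T.pushDisc t e = e := by
  obtain ⟨⟨c, v⟩, hv⟩ := e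
  simp [pushDisc, stretch, he]

theorem continuousOn_pushDisc :
    ContinuousOn (fun p : I × T.Disc => T.pushDisc p.1 p.2) {p | T.radius p.2 ≠ 0} := by
  rw [IsEmbedding.subtypeVal.isInducing.continuousOn_iff]
  refine continuous_smul_totalSpace.comp_continuousOn
    (f := fun p : I × T.Disc => (stretch p.1 (T.radius p.2), p.2.1)) (ContinuousOn.prodMk ?_ ?_)
  · have hr : Continuous fun p : I × T.Disc => T.radius p.2 :=
      T.continuous_radius.comp continuous_snd
    have ht : Continuous fun p : I × T.Disc => (p.1 : ℝ) :=
      continuous_subtype_val.comp continuous_fst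
    exact (continuous_const.sub ht).continuousOn.add
      (ht.continuousOn.mul (hr.continuousOn.inv₀ fun _ h => h))
  · exact (continuous_subtype_val.comp continuous_snd).continuousOn

open Classical in
/-- The radial deformation of the tubular neighbourhood to the circle bundle, extended by the
identity. -/
noncomputable def push (t : I) (z : M) : M :=
  if h : z ∈ T.closedTube then T.emb (T.pushDisc t h.choose) else z

theorem push_emb (t : I) (e : T.Disc) : T.push t (T.emb e) = T.emb (T.pushDisc t e) := by
  have h : T.emb e ∈ T.closedTube := mem_range_self e
  rw [push, dif_pos h, T.emb_injective h.choose_spec]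

theorem push_of_notMem_openTube (t : I) {z : M} (hz : z ∉ T.openTube) : T.push t z = z := by
  by_cases h : z ∈ T.closedTube
  · obtain ⟨e, rfl⟩ := h
    rw [emb_mem_openTube_iff, not_lt] at hz
    rw [push_emb, pushDisc_of_radius_eq_one T t (le_antisymm (T.radius_le_one e) hz)]
  · rw [push, dif_neg h]

theorem push_zero (z : M) : T.push 0 z = z := by
  by_cases h : z ∈ T.closedTube
  · obtain ⟨e, rfl⟩ := h
    rw [push_emb, pushDisc_zero]
  · rw [push, dif_neg h]

theorem push_one_notMem_openTube {z : M} (hz : z ∉ C) : T.push 1 z ∉ T.openTube := by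
  by_cases h : z ∈ T.openTube
  · obtain ⟨e, -, rfl⟩ := h
    rw [emb_mem_iff] at hz
    rw [push_emb, emb_mem_openTube_iff, radius_pushDisc T 1 hz]
    simp
  · rwa [push_of_notMem_openTube T 1 h]

theorem push_notMem (t : I) {z : M} (hz : z ∉ C) : T.push t z ∉ C := by
  by_cases h : z ∈ T.openTube
  · obtain ⟨e, -, rfl⟩ := h
    rw [emb_mem_iff] at hz
    rw [push_emb, emb_mem_iff]
    exact (T.radius_pushDisc_pos t hz).ne'
  · rwa [push_of_notMem_openTube T t h]

/-- Gluing over two relatively closed pieces of the complement of `C`: the punctured closed tube,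
where the map is the radial one, and the complement of the open tube, where it is the identity. -/
theorem continuousOn_push (hT : IsClosed T.closedTube) :
    ContinuousOn (fun p : I × M => T.push p.1 p.2) (univ ×ˢ Cᶜ) := by
  have hin : ContinuousOn (fun p : I × M => T.push p.1 p.2) (univ ×ˢ (T.closedTube \ C)) := by
    have himage : (univ ×ˢ (T.closedTube \ C) : Set (I × M)) =
        Prod.map id T.emb '' {p | T.radius p.2 ≠ 0} := by
      ext ⟨t, z⟩
      constructor
      · rintro ⟨-, ⟨e, rfl⟩, he⟩
        exact ⟨(t, e), mt T.emb_mem_iff.2 he, rfl⟩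
      · rintro ⟨⟨s, e⟩, he, h⟩
        obtain ⟨-, rfl⟩ := Prod.mk.inj h
        exact ⟨mem_univ _, mem_range_self e, mt T.emb_mem_iff.1 he⟩
    rw [himage, (IsInducing.id.prodMap T.isEmbedding.isInducing).continuousOn_image_iff]
    refine (T.isEmbedding.continuous.comp_continuousOn T.continuousOn_pushDisc).congr ?_
    exact fun p _ => T.push_emb p.1 p.2
  have hout : ContinuousOn (fun p : I × M => T.push p.1 p.2) (univ ×ˢ T.openTubeᶜ) :=
    continuous_snd.continuousOn.congr fun p hp => T.push_of_notMem_openTube p.1 hp.2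
  rintro ⟨t, z⟩ ⟨-, hz⟩
  have hunion : (univ ×ˢ Cᶜ : Set (I × M)) ⊆
      univ ×ˢ (T.closedTube \ C) ∪ univ ×ˢ T.openTubeᶜ := by
    rintro ⟨s, w⟩ ⟨-, hw⟩
    by_cases h : w ∈ T.openTube
    · exact Or.inl ⟨mem_univ _, T.openTube_subset_closedTube h, hw⟩
    · exact Or.inr ⟨mem_univ _, h⟩
  refine ContinuousWithinAt.mono (ContinuousWithinAt.union ?_ ?_) hunion
  · by_cases h : z ∈ T.closedTube
    · exact hin _ ⟨mem_univ _, h, hz⟩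
    · refine continuousWithinAt_of_notMem_closure fun hcl => h ?_
      exact (closure_minimal (prod_mono subset_rfl sdiff_subset) (isClosed_univ.prod hT) hcl).2
  · by_cases h : z ∈ T.openTube
    · refine continuousWithinAt_of_notMem_closure fun hcl => ?_
      rw [(isClosed_univ.prod T.isOpen_openTube.isClosed_compl).closure_eq] at hcl
      exact hcl.2 h
    · exact hout _ ⟨mem_univ _, h⟩

end TubularNbhd

/-! ### Compatibility of different tubes -/

namespace TubularSystem

variable {M : Type*} [TopologicalSpace M] {ι : Type*} {C : ι → Set M} (T : TubularSystem C)

/-- If a point of the `i`-th tube lies in the `j`-th tube, then the fibre through this point lies in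
a bidisc, in which it is given by fixing the first coordinate. -/
theorem exists_chart_of_base_eq {i j : ι} (hij : i ≠ j) {e e' : (T.tube i).Disc}
    (hb : (T.tube i).base e' = (T.tube i).base e) (he : (T.tube i).emb e ∈ (T.tube j).closedTube) :
    ∃ q, ∃ g : ClosedDisc × ClosedDisc → M, IsBidiscChart (T.tube i) (T.tube j) q (T.N q) g ∧
      (T.N q ⊆ (T.tube j).closedTube) ∧
      ∃ x y y', (T.tube i).emb e = g (x, y) ∧ (T.tube i).emb e' = g (x, y') := by
  have hmem : (T.tube i).emb e ∈ ⋃ q ∈ C i ∩ C j, T.N q := by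
    rw [← T.tube_inter i j hij]
    exact ⟨mem_range_self e, he⟩
  obtain ⟨q, hq, hN⟩ := mem_iUnion₂.1 hmem
  obtain ⟨g, hg⟩ := T.chart i j hij q hq
  refine ⟨q, g, hg, ?_, ?_⟩
  · exact (subset_biUnion_of_mem (u := T.N) hq).trans
      ((T.tube_inter i j hij).symm.subset.trans inter_subset_right)
  rw [← hg.range_eq] at hN
  obtain ⟨⟨x, y⟩, hxy⟩ := hN
  have hbase := hg.base_left e x y hxy.symm
  have hN' : (T.tube i).emb e' ∈ T.N q := by
    refine hg.saturated_left e' ?_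
    rw [hb, hbase, ← hg.range_eq]
    exact mem_range_self _
  rw [← hg.range_eq] at hN'
  obtain ⟨⟨x', y'⟩, hxy'⟩ := hN'
  have hbase' := hg.base_left e' x' y' hxy'.symm
  rw [hb, hbase] at hbase'
  obtain ⟨rfl, -⟩ := Prod.mk.inj (hg.isEmbedding.injective hbase')
  exact ⟨x, y, y', hxy.symm, hxy'.symm⟩

theorem emb_mem_openTube_of_base_eq {i j : ι} (hij : i ≠ j) {e e' : (T.tube i).Disc}
    (hb : (T.tube i).base e' = (T.tube i).base e) (he : (T.tube i).emb e ∈ (T.tube j).openTube) :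
    (T.tube i).emb e' ∈ (T.tube j).openTube := by
  obtain ⟨q, g, hg, hN, x, y, y', hxy, hxy'⟩ :=
    T.exists_chart_of_base_eq hij hb ((T.tube j).openTube_subset_closedTube he)
  obtain ⟨f, hf, hfe⟩ := he
  have hmem : (T.tube i).emb e' ∈ T.N q := by
    rw [hxy', ← hg.range_eq]
    exact mem_range_self _
  obtain ⟨f', hf'⟩ := hN hmem
  rw [← hf', TubularNbhd.emb_mem_openTube_iff]
  -- The chart controls the `j`-radius only through the condition that it equals `1`, which is `‖x‖
  -- = 1`; both points share `x`, so neither or both have radius `1`.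
  refine lt_of_le_of_ne ((T.tube j).radius_le_one f') fun h => ?_
  exact (ne_of_lt hf) ((hg.radius_right f x y (hfe.trans hxy)).2
    ((hg.radius_right f' x y' (hf'.trans hxy')).1 h))

theorem emb_mem_of_base_eq {i j : ι} (hij : i ≠ j) {e e' : (T.tube i).Disc}
    (hb : (T.tube i).base e' = (T.tube i).base e) (he : (T.tube i).emb e ∈ C j) :
    (T.tube i).emb e' ∈ C j := by
  obtain ⟨q, g, hg, hN, x, y, y', hxy, hxy'⟩ := T.exists_chart_of_base_eq hij hb
    ((T.tube j).openTube_subset_closedTube ((T.tube j).subset_openTube he))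
  rw [hxy, hg.mem_right] at he
  rw [hxy', hg.mem_right]
  exact he

/-- A point and its base point lie in one fibre. This translates `core`, a condition on base points,
into a condition on the points of the circle bundle. -/
theorem base_mem_openTube_iff {i j : ι} (hij : i ≠ j) (e : (T.tube i).Disc) :
    (T.tube i).base e ∈ (T.tube j).openTube ↔ (T.tube i).emb e ∈ (T.tube j).openTube := by
  rw [show (T.tube i).base e = (T.tube i).emb ((T.tube i).zero e.1.1) from
    ((T.tube i).emb_zero_eq e.1.1).symm]
  exact ⟨T.emb_mem_openTube_of_base_eq hij rfl, T.emb_mem_openTube_of_base_eq hij rfl⟩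

/-- The boundary manifold consists of the points of `T(V)` outside all the open tubes. -/
theorem boundary_eq : T.boundary = T.nbhd \ ⋃ i, (T.tube i).openTube := by
  ext z
  simp only [boundary, nbhd, mem_sdiff, mem_iUnion, not_exists]
  constructor
  · rintro ⟨i, e, ⟨hr, hb, hcore⟩, rfl⟩
    refine ⟨⟨i, mem_range_self e⟩, fun j hj => ?_⟩
    rcases eq_or_ne i j with rfl | hij
    · rw [TubularNbhd.emb_mem_openTube_iff] at hj
      exact hj.ne hr
    · exact hcore (mem_iUnion₂.2 ⟨j, hij.symm, (T.tube i).subset_openTube hb,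
        (T.base_mem_openTube_iff hij e).2 hj⟩)
  · rintro ⟨⟨i, e, rfl⟩, hz⟩
    refine ⟨i, e, ⟨?_, e.1.1.2, fun hb => ?_⟩, rfl⟩
    · have := hz i
      rw [TubularNbhd.emb_mem_openTube_iff, not_lt] at this
      exact le_antisymm ((T.tube i).radius_le_one e) this
    · obtain ⟨j, hji, -, hj⟩ := mem_iUnion₂.1 hb
      exact hz j ((T.base_mem_openTube_iff hji.symm e).1 hj)

theorem push_mem_nbhd (i : ι) (t : I) {z : M} (hz : z ∈ T.nbhd) : (T.tube i).push t z ∈ T.nbhd := by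
  by_cases h : z ∈ (T.tube i).openTube
  · obtain ⟨e, -, rfl⟩ := h
    rw [TubularNbhd.push_emb]
    exact mem_iUnion.2 ⟨i, mem_range_self _⟩
  · rwa [TubularNbhd.push_of_notMem_openTube _ t h]

theorem push_notMem_openTube {i j : ι} (hij : i ≠ j) (t : I) {z : M}
    (hz : z ∉ (T.tube j).openTube) : (T.tube i).push t z ∉ (T.tube j).openTube := by
  by_cases h : z ∈ (T.tube i).openTube
  · obtain ⟨e, -, rfl⟩ := h
    rw [TubularNbhd.push_emb]
    exact mt (T.emb_mem_openTube_of_base_eq hij ((T.tube i).base_pushDisc t e).symm) hz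
  · rwa [TubularNbhd.push_of_notMem_openTube _ t h]

theorem push_notMem_iUnion (i : ι) (t : I) {z : M} (hz : z ∉ ⋃ j, C j) :
    (T.tube i).push t z ∉ ⋃ j, C j := by
  simp only [mem_iUnion, not_exists] at hz ⊢
  intro j
  rcases eq_or_ne i j with rfl | hij
  · exact (T.tube i).push_notMem t (hz i)
  by_cases h : z ∈ (T.tube i).openTube
  · obtain ⟨e, -, rfl⟩ := h
    rw [TubularNbhd.push_emb]
    exact mt (T.emb_mem_of_base_eq hij ((T.tube i).base_pushDisc t e).symm) (hz j)
  · rw [TubularNbhd.push_of_notMem_openTube _ t h]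
    exact hz j

/-- The radial deformation of the `i`-th tube, as a deformation of `T(V) ∖ V`. -/
noncomputable def pushHomotopy (i : ι) (hT : IsClosed (T.tube i).closedTube) :
    C(I × ↥(T.nbhd \ ⋃ j, C j), ↥(T.nbhd \ ⋃ j, C j)) where
  toFun p := ⟨(T.tube i).push p.1 p.2,
    T.push_mem_nbhd i p.1 p.2.2.1, T.push_notMem_iUnion i p.1 p.2.2.2⟩
  continuous_toFun := by
    refine Continuous.subtype_mk ?_ _
    refine ((T.tube i).continuousOn_push hT).comp_continuous
      (f := fun p : I × ↥(T.nbhd \ ⋃ j, C j) => (p.1, (p.2 : M))) (by fun_prop) fun p => ?_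
    exact ⟨mem_univ _, fun h => p.2.2.2 (mem_iUnion.2 ⟨i, h⟩)⟩

end TubularSystem

/-! ### Composing the deformations -/

/-- Finitely many homotopies, each of which moves the points of `U i` out of `U i`, fixes all other
points, and moves no point into one of the sets `U j`, can be composed to a homotopy that moves all
points out of all the sets `U i`. -/
theorem exists_homotopy_compl_iUnion {A ι : Type*} [TopologicalSpace A] [Finite ι] (U : ι → Set A)
    (G : ι → C(I × A, A)) (h_zero : ∀ i x, G i (0, x) = x)
    (h_one : ∀ i x, G i (1, x) ∉ U i) (h_fix : ∀ i t, ∀ x ∉ U i, G i (t, x) = x)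
    (h_compl : ∀ i j t, ∀ x ∉ U j, G i (t, x) ∉ U j) :
    ∃ H : C(I × A, A), (∀ x, H (0, x) = x) ∧ (∀ x i, H (1, x) ∉ U i) ∧
      ∀ t x, (∀ i, x ∉ U i) → H (t, x) = x := by
  classical
  have := Fintype.ofFinite ι
  suffices h : ∀ s : Finset ι, ∃ H : C(I × A, A), (∀ x, H (0, x) = x) ∧
      (∀ x, ∀ i ∈ s, H (1, x) ∉ U i) ∧ ∀ t x, (∀ i, x ∉ U i) → H (t, x) = x by
    obtain ⟨H, h0, h1, h2⟩ := h Finset.univ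
    exact ⟨H, h0, fun x i => h1 x i (Finset.mem_univ i), h2⟩
  intro s
  induction s using Finset.induction_on with
  | empty => exact ⟨ContinuousMap.snd, by simp, by simp, by simp⟩
  | insert i s _ ih =>
    obtain ⟨H, h0, h1, h2⟩ := ih
    -- Both homotopies run with the same time parameter: `(t, x) ↦ G i (t, H (t, x))`.
    refine ⟨(G i).comp (ContinuousMap.fst.prodMk H), fun x => ?_, fun x j hj => ?_,
      fun t x hx => ?_⟩
    · simp [h0, h_zero]
    · rcases Finset.mem_insert.1 hj with rfl | hj
      · exact h_one _ _
      · exact h_compl _ _ _ _ (h1 x j hj)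
    · change G i (t, H (t, x)) = x
      rw [h2 t x hx, h_fix i t x (hx i)]

/-- The punctured tubular neighbourhood of a finite union of compact sets in a Hausdorff space
deformation retracts to the boundary manifold. -/
theorem TubularSystem.hasDeformationRetraction {M : Type*} [TopologicalSpace M] [T2Space M]
    {ι : Type*} [Finite ι] {C : ι → Set M} (hC : ∀ i, IsCompact (C i)) (T : TubularSystem C) :
    HasDeformationRetraction (T.nbhd \ ⋃ i, C i) T.boundary := by
  rw [HasDeformationRetraction, T.boundary_eq]
  refine ⟨sdiff_subset_sdiff_right (iUnion_mono fun i => (T.tube i).subset_openTube), ?_⟩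
  have hT i := (T.tube i).isClosed_closedTube (hC i)
  obtain ⟨H, h0, h1, h2⟩ := exists_homotopy_compl_iUnion
    (fun i => {x : ↥(T.nbhd \ ⋃ j, C j) | (x : M) ∈ (T.tube i).openTube})
    (fun i => T.pushHomotopy i (hT i))
    (fun i x => Subtype.ext ((T.tube i).push_zero x))
    (fun i x => (T.tube i).push_one_notMem_openTube fun h => x.2.2 (mem_iUnion.2 ⟨i, h⟩))
    (fun i t x hx => Subtype.ext ((T.tube i).push_of_notMem_openTube t hx))
    (fun i j t x hx => by
      rcases eq_or_ne i j with rfl | hij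
      · change (T.tube i).push t x ∉ (T.tube i).openTube
        rwa [TubularNbhd.push_of_notMem_openTube _ t hx]
      · exact T.push_notMem_openTube hij t hx)
  refine ⟨H, h0, fun x => ⟨(H (1, x)).2.1, ?_⟩, fun t x hx => h2 t x fun i hi => ?_⟩
  · rw [mem_iUnion, not_exists]
    exact h1 x
  · exact hx.2 (mem_iUnion.2 ⟨i, hi⟩)

/-! ### Projective space is compact Hausdorff, and algebraic sets are closed -/

namespace PSpace

variable {n : ℕ}

theorem isQuotientMap_mk' :
    IsQuotientMap (Projectivization.mk' ℂ : {v : Fin (n + 1) → ℂ // v ≠ 0} → PSpace n) :=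
  ⟨⟨rfl⟩, Quotient.mk''_surjective⟩

theorem sum_mul_conj_ne_zero {v : Fin (n + 1) → ℂ} (hv : v ≠ 0) :
    ∑ k, v k * star (v k) ≠ 0 := by
  have h (k : Fin (n + 1)) : v k * star (v k) = ((‖v k‖ ^ 2 : ℝ) : ℂ) := by
    simpa using Complex.mul_conj' (v k)
  simp only [h, ← Complex.ofReal_sum, ne_eq, Complex.ofReal_eq_zero]
  rw [Finset.sum_eq_zero_iff_of_nonneg fun _ _ => by positivity]
  simpa [funext_iff] using hv

/-- The matrix of the orthogonal projection onto a line in `ℂ ^ (n + 1)`. -/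
noncomputable def projMatrix : PSpace n → Matrix (Fin (n + 1)) (Fin (n + 1)) ℂ :=
  Projectivization.lift
    (fun v => Matrix.of fun i j => v.1 i * star (v.1 j) / ∑ k, v.1 k * star (v.1 k)) <| by
    rintro ⟨_, hv⟩ ⟨w, hw⟩ t rfl
    have ht : t ≠ 0 := by rintro rfl; simp at hv
    have hs : star t ≠ 0 := star_ne_zero.2 ht
    ext i j
    have h : ∑ k, (t • w) k * star ((t • w) k) = (t * star t) * ∑ k, w k * star (w k) := by
      rw [Finset.mul_sum]
      refine Finset.sum_congr rfl fun k _ => ?_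
      simp only [Pi.smul_apply, smul_eq_mul, star_mul']
      ring
    simp only [Matrix.of_apply]
    rw [h, ← mul_div_mul_left (w i * star (w j)) _ (mul_ne_zero ht hs)]
    simp only [Pi.smul_apply, smul_eq_mul, star_mul']
    ring

theorem continuous_projMatrix : Continuous (projMatrix (n := n)) := by
  rw [isQuotientMap_mk'.continuous_iff]
  refine continuous_matrix fun i j => ?_
  change Continuous fun v : {v : Fin (n + 1) → ℂ // v ≠ 0} =>
    v.1 i * star (v.1 j) / ∑ k, v.1 k * star (v.1 k)
  have hc (k : Fin (n + 1)) : Continuous fun v : {v : Fin (n + 1) → ℂ // v ≠ 0} => v.1 k :=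
    (continuous_apply k).comp continuous_subtype_val
  exact ((hc i).mul (hc j).star).div (continuous_finsetSum _ fun k _ => (hc k).mul (hc k).star)
    fun v => sum_mul_conj_ne_zero v.2

theorem projMatrix_injective : Function.Injective (projMatrix (n := n)) := by
  intro p q h
  obtain ⟨⟨v, hv⟩, rfl⟩ := isQuotientMap_mk'.surjective p
  obtain ⟨⟨w, hw⟩, rfl⟩ := isQuotientMap_mk'.surjective q
  obtain ⟨j, hj⟩ := Function.ne_iff.1 hv
  have hij (i : Fin (n + 1)) : v i * star (v j) / (∑ k, v k * star (v k)) =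
    w i * star (w j) / ∑ k, w k * star (w k) := congrFun₂ h i j
  rw [Projectivization.mk'_eq_mk, Projectivization.mk'_eq_mk, Projectivization.mk_eq_mk_iff']
  -- The `j`-th columns of the two matrices are multiples of `v` and `w`; this scalar solves their
  -- equality for `v`, using `v j ≠ 0`.
  refine ⟨star (w j) / (∑ k, w k * star (w k)) * (∑ k, v k * star (v k)) / star (v j), ?_⟩
  have hv' := sum_mul_conj_ne_zero hv
  have hs : star (v j) ≠ 0 := star_ne_zero.2 hj
  ext i
  have := hij i
  rw [div_eq_iff hv'] at this
  rw [Pi.smul_apply, smul_eq_mul, div_mul_eq_mul_div, div_eq_iff hs, this]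
  ring

instance : T2Space (PSpace n) :=
  T2Space.of_injective_continuous projMatrix_injective continuous_projMatrix

instance : CompactSpace (PSpace n) := by
  let f : Metric.sphere (0 : Fin (n + 1) → ℂ) 1 → {v : Fin (n + 1) → ℂ // v ≠ 0} :=
    fun v => ⟨v.1, ne_zero_of_mem_unit_sphere v⟩
  have hf : Continuous f := continuous_subtype_val.subtype_mk _
  refine Function.Surjective.compactSpace (f := Projectivization.mk' ℂ ∘ f)
    (isQuotientMap_mk'.continuous.comp hf) fun p => ?_
  obtain ⟨⟨v, hv⟩, rfl⟩ := isQuotientMap_mk'.surjective p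
  have hn : ‖v‖ ≠ 0 := norm_ne_zero_iff.2 hv
  refine ⟨⟨((‖v‖ : ℂ)⁻¹) • v, by simp [norm_smul, hn]⟩, ?_⟩
  exact (Projectivization.mk_eq_mk_iff' ℂ _ _ _ _).2 ⟨_, rfl⟩

theorem eval_smul_of_isHomogeneous {ι R : Type*} [Fintype ι] [CommSemiring R]
    {f : MvPolynomial ι R} {d : ℕ} (hf : f.IsHomogeneous d) (a : R) (v : ι → R) :
    MvPolynomial.eval (a • v) f = a ^ d * MvPolynomial.eval v f := by
  rw [MvPolynomial.eval_eq', MvPolynomial.eval_eq', Finset.mul_sum]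
  refine Finset.sum_congr rfl fun m hm => ?_
  have hd : ∑ i, m i = d := by
    rw [← Finsupp.degree_eq_sum, Finsupp.degree_eq_weight_one]
    exact hf (MvPolynomial.mem_support_iff.1 hm)
  simp only [Pi.smul_apply, smul_eq_mul, mul_pow, Finset.prod_mul_distrib,
    Finset.prod_pow_eq_pow_sum, hd]
  ring

theorem vanishesAt_mk_iff {f : MvPolynomial (Fin (n + 1)) ℂ} (hf : IsForm f)
    {v : Fin (n + 1) → ℂ} (hv : v ≠ 0) :
    VanishesAt f (Projectivization.mk ℂ v hv) ↔ MvPolynomial.eval v f = 0 := by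
  obtain ⟨d, hd⟩ := hf
  obtain ⟨a, ha⟩ := Projectivization.exists_smul_eq_mk_rep ℂ v hv
  rw [VanishesAt, ← ha, Units.smul_def, eval_smul_of_isHomogeneous hd, mul_eq_zero]
  simp

end PSpace

/-- Projective algebraic sets are closed in the complex topology. -/
theorem IsProjAlgebraic.isClosed {n : ℕ} {Z : Set (PSpace n)} (hZ : IsProjAlgebraic Z) :
    IsClosed Z := by
  obtain ⟨S, hS, rfl⟩ := hZ
  rw [← PSpace.isQuotientMap_mk'.isClosed_preimage]
  have : Projectivization.mk' ℂ ⁻¹' {p : PSpace n | ∀ f ∈ S, VanishesAt f p} =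
      ⋂ f ∈ S, {v : {v : Fin (n + 1) → ℂ // v ≠ 0} | MvPolynomial.eval v.1 f = 0} := by
    ext v
    simp only [mem_preimage, mem_ofPred_eq, mem_iInter]
    exact forall₂_congr fun f hf => PSpace.vanishesAt_mk_iff (hS f hf) v.2
  rw [this]
  exact isClosed_biInter fun f _ => isClosed_eq
    ((MvPolynomial.continuous_eval f).comp continuous_subtype_val) continuous_const

theorem lemma3p1 {n k : ℕ} (X : Set (PSpace n)) (hX : IsSmoothProjective 2 X)
    (C : Fin k → Set X) (hC : IsNormalCrossingCurve X C) (T : TubularSystem C) :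
    HasDeformationRetraction (T.nbhd \ ⋃ i, C i) T.boundary := by
  refine T.hasDeformationRetraction fun i => ?_
  rw [Subtype.isCompact_iff]
  exact (hC.smooth i).1.isClosed.isCompact
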